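/- Let $K$ be a field with nine elements, let $\zeta\in K$ satisfy $\zeta^2=1-\zeta$ (so $\zeta$ is a primitive element of $K$), and let $v\neq w$ be two points outside $\mathbb{P}^1(K)=K\cup\{\infty\}$. Write $[x,y]=xyx^{-1}y^{-1}$ and $x^y=y^{-1}xy$; permutations are composed as maps (right factor first). Let $\mathrm{M}(3^2)$ be the group of all permutations $\omega\mapsto\frac{p\,\theta(\omega)+q}{r\,\theta(\omega)+s}$ of $\mathbb{P}^1(K)$ with $p,q,r,s\in K$ and $\Delta=ps-qr\neq0$, where $\theta$ is the identity if $\Delta$ is a square in $K$, and $\theta(\omega)=\omega^3$ $(\omega\in K)$, $\theta(\infty)=\infty$ otherwise; let it act on the twelve points $K\cup\{\infty,v,w\}$ fixing $v$ and $w$. Let $S_4$ and $S_5$ be the permutations of these twelve points such that $S_4$ interchanges $\infty$ and $v$, fixes $w$, and maps $\alpha+\zeta\beta\mapsto\alpha-\zeta\beta$ for $\alpha,\beta$ in the prime field of $K$, while $S_5$ interchanges $v$ and $w$, fixes $\infty$, and maps $\omega\mapsto\omega^3$ for $\omega\in K$. Let $M_{11}=\langle \mathrm{M}(3^2),S_4\rangle$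 and $M_{12}=\langle M_{11},S_5\rangle$ (Witt's construction of the Mathieu groups). **Proposition.** The group $M_{12}$ is generated by the permutations $$a:\omega\mapsto\zeta^{-1}\omega^3,\qquad T:\omega\mapsto1-\omega,\qquad J:\omega\mapsto\omega^{-1},\qquad U=S_4,\qquad V=S_5$$ (where $a$ and $T$ fix $\infty$, $J$ interchanges $0$ and $\infty$, and $a,T,J$ fix $v$ and $w$), and in these generators it has the defining relations $$T^2=J^2=(JT)^3=(Ta^2)^3=[J,a]^4=(J[J,a])^2=1,\quad a^2=[J,a]^2,\quad (aT)^2=T^{[J,a]},$$ $$U^2=(UT)^2=(UJ)^3=1,\quad a^U=[J,a],$$ $$V^2=(VT)^2=(VJ)^2=(VU)^3=1,\quad a^V=[J,a]^{-1}a,\quad [J,a]^V=[J,a]^{-1}.$$ That is, the abstract group presented by the symbols $a,T,J,U,V$ and these relations is isomorphic to $M_{12}$ via the map sending each symbol to the permutation of the same name. -/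

import Mathlib

open OnePoint

namespace Mathieu

/-! ### The group `M(3²)` on the projective line over a field `K` with nine elements -/

/-- The permutation of the projective line `OnePoint K = K ∪ {∞}` that fixes `∞` and acts on `K`
as `e`. -/
def affinePerm {K : Type*} (e : Equiv.Perm K) : Equiv.Perm (OnePoint K) where
  toFun := OnePoint.map e
  invFun := OnePoint.map e.symm
  left_inv p := by cases p <;> simp
  right_inv p := by cases p <;> simp

/-- The cubing map `ω ↦ ω ^ 3` on a field with nine elements. -/
def cubePerm {K : Type*} [Field K] (hK : Nat.card K = 9) : Equiv.Perm K :=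
  Function.Involutive.toPerm (fun x => x ^ 3) (by
    intro x
    have : Finite K := Nat.finite_of_card_ne_zero (by omega)
    have : Fintype K := Fintype.ofFinite K
    have h := FiniteField.pow_card x
    rw [Fintype.card_eq_nat_card, hK] at h
    show (x ^ 3) ^ 3 = x
    rw [← pow_mul]
    exact h)

/-- The Zassenhaus group `M(3²)`: the permutations
`ω ↦ (a β(ω) + b) / (c β(ω) + d)` of `K ∪ {∞}` with `Δ = a d - b c ≠ 0`, where `β` is the identity
if `Δ` is a square in `K`, and `β(ω) = ω ^ 3`, `β(∞) = ∞` if `Δ` is not a square. (These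
permutations already form a group; `GL (Fin 2) K` acts on `OnePoint K` by Möbius
transformations.) -/
def zassenhaus {K : Type*} [Field K] [DecidableEq K] (hK : Nat.card K = 9) :
    Subgroup (Equiv.Perm (OnePoint K)) :=
  Subgroup.closure {h | ∃ A : GL (Fin 2) K,
    (IsSquare (A : Matrix (Fin 2) (Fin 2) K).det ∧ ∀ ω, h ω = A • ω) ∨
    (¬ IsSquare (A : Matrix (Fin 2) (Fin 2) K).det ∧
      ∀ ω, h ω = A • affinePerm (cubePerm hK) ω)}

/-! ### The twelve points and the distinguished permutations -/

/-- Two new points outside the projective line. -/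
inductive NewPoint
  | v
  | w
  deriving DecidableEq

/-- The set `K ∪ {∞} ∪ {v, w}`. -/
abbrev Points (K : Type*) := OnePoint K ⊕ NewPoint

/-- A permutation of `K ∪ {∞}`, extended so as to fix `v` and `w`. -/
def extend {K : Type*} (h : Equiv.Perm (OnePoint K)) : Equiv.Perm (Points K) :=
  Equiv.sumCongr h (Equiv.refl NewPoint)

/-- `a : ω ↦ ζ⁻¹ ω ^ 3`, fixing `∞`. -/
def permA {K : Type*} [Field K] (hK : Nat.card K = 9) (ζ : K) (hζ : ζ ^ 2 = 1 - ζ) :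
    Equiv.Perm (OnePoint K) :=
  affinePerm ((cubePerm hK).trans (Equiv.mulLeft₀ ζ⁻¹ (inv_ne_zero (by
    rintro rfl
    norm_num at hζ))))

/-- `T : ω ↦ 1 - ω`, fixing `∞`. -/
def permT {K : Type*} [Field K] : Equiv.Perm (OnePoint K) :=
  affinePerm (Equiv.subLeft 1)

/-- The map `ω ↦ ω⁻¹`, interchanging `0` and `∞`. -/
def invMap {K : Type*} [Field K] [DecidableEq K] (p : OnePoint K) : OnePoint K :=
  OnePoint.elim p ((0 : K) : OnePoint K) (fun x => if x = 0 then ∞ else ((x⁻¹ : K) : OnePoint K))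

/-- `J : ω ↦ ω⁻¹`, interchanging `0` and `∞`. -/
def permJ {K : Type*} [Field K] [DecidableEq K] : Equiv.Perm (OnePoint K) :=
  Function.Involutive.toPerm invMap (by
    intro p
    cases p with
    | infty => simp [invMap]
    | coe x => by_cases hx : x = 0 <;> simp [invMap, hx])

theorem three_eq_zero {K : Type*} [Field K] (hK : Nat.card K = 9) : (3 : K) = 0 := by
  have : Finite K := Nat.finite_of_card_ne_zero (by omega)
  have : Fintype K := Fintype.ofFinite K
  have h := FiniteField.cast_card_eq_zero K
  rw [Fintype.card_eq_nat_card, hK] at h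
  have h2 : (3 : K) ^ 2 = 0 := by
    rw [← h]
    norm_num
  exact pow_eq_zero_iff (two_ne_zero) |>.1 h2

/-- The permutation `α + ζ β ↦ α - ζ β` (for `α, β` in the prime field) of `K`, written as a
polynomial function of the element of `K`; see `conjPerm_apply`. -/
def conjPerm {K : Type*} [Field K] (hK : Nat.card K = 9) (ζ : K) (hζ : ζ ^ 2 = 1 - ζ) :
    Equiv.Perm K :=
  Function.Involutive.toPerm (fun x => (ζ - 1) * x - (1 + ζ) * x ^ 3) (by
    intro x
    have h3 := three_eq_zero hK
    have h9 : x ^ 9 = x := by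
      have h := (cubePerm hK).left_inv x
      change (x ^ 3) ^ 3 = x at h
      rw [← pow_mul] at h
      exact h
    show (ζ - 1) * ((ζ - 1) * x - (1 + ζ) * x ^ 3)
      - (1 + ζ) * ((ζ - 1) * x - (1 + ζ) * x ^ 3) ^ 3 = x
    have hcube : ((ζ - 1) * x - (1 + ζ) * x ^ 3) ^ 3
        = (ζ - 1) ^ 3 * x ^ 3 - (1 + ζ) ^ 3 * x ^ 9 := by
      linear_combination (-((ζ - 1) * x) ^ 2 * ((1 + ζ) * x ^ 3)
        + ((ζ - 1) * x) * ((1 + ζ) * x ^ 3) ^ 2) * h3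
    rw [hcube, h9]
    grind)

/-- The defining property of `conjPerm`; every element of `K` is `α + ζ β` with `α, β` in the
prime field, that is, with `α, β` images of integers. -/
theorem conjPerm_apply {K : Type*} [Field K] (hK : Nat.card K = 9) (ζ : K)
    (hζ : ζ ^ 2 = 1 - ζ) (α β : ℤ) :
    conjPerm hK ζ hζ (α + ζ * β) = α - ζ * β := by
  have h3 := three_eq_zero hK
  have hc : ∀ n : ℤ, (n : K) ^ 3 = n := by
    intro n
    obtain ⟨m, hm⟩ : ∃ m : ℤ, n = 3 * m ∨ n = 3 * m + 1 ∨ n = 3 * m + 2 := ⟨n / 3, by omega⟩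
    rcases hm with rfl | rfl | rfl <;> push_cast <;> rw [h3] <;> grind
  show (ζ - 1) * (α + ζ * β) - (1 + ζ) * (α + ζ * β : K) ^ 3 = α - ζ * β
  have hcube : (α + ζ * β : K) ^ 3 = α + ζ ^ 3 * β := by
    have h1 := hc α
    have h2 := hc β
    linear_combination h1 + ζ ^ 3 * h2 + ((α : K) ^ 2 * (ζ * β) + α * (ζ * β) ^ 2) * h3
  rw [hcube]
  grind

/-- The map interchanging `∞` and `v`, fixing `w`, and acting on `K` as `conjPerm`. -/
def conjMap {K : Type*} [Field K] (hK : Nat.card K = 9) (ζ : K) (hζ : ζ ^ 2 = 1 - ζ) :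
    Points K → Points K
  | Sum.inl p => OnePoint.elim p (Sum.inr NewPoint.v)
      (fun x => Sum.inl ((conjPerm hK ζ hζ x : K) : OnePoint K))
  | Sum.inr NewPoint.v => Sum.inl ∞
  | Sum.inr NewPoint.w => Sum.inr NewPoint.w

/-- `U = S₄`: it interchanges `∞` and `v`, fixes `w`, and maps `α + ζ β` to `α - ζ β` for `α, β`
in the prime field. -/
def permU {K : Type*} [Field K] (hK : Nat.card K = 9) (ζ : K) (hζ : ζ ^ 2 = 1 - ζ) :
    Equiv.Perm (Points K) :=
  Function.Involutive.toPerm (conjMap hK ζ hζ) (by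
    rintro (p | q)
    · cases p with
      | infty => rfl
      | coe x =>
        have hx : conjPerm hK ζ hζ (conjPerm hK ζ hζ x) = x := (conjPerm hK ζ hζ).left_inv x
        simp [conjMap, hx]
    · cases q <;> rfl)

/-- `V = S₅`: it interchanges `v` and `w`, fixes `∞`, and maps `ω ∈ K` to `ω ^ 3`. -/
def permV {K : Type*} [Field K] (hK : Nat.card K = 9) : Equiv.Perm (Points K) :=
  Equiv.sumCongr (affinePerm (cubePerm hK)) (Equiv.swap NewPoint.v NewPoint.w)

/-! ### The Mathieu groups `M₁₁` and `M₁₂` by Witt's construction -/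

/-- `M₁₁ = ⟨M(3²), S₄⟩`, as a group of permutations of the twelve points fixing `w`. -/
def M11 {K : Type*} [Field K] [DecidableEq K] (hK : Nat.card K = 9) (ζ : K)
    (hζ : ζ ^ 2 = 1 - ζ) : Subgroup (Equiv.Perm (Points K)) :=
  Subgroup.closure (extend '' (zassenhaus hK : Set (Equiv.Perm (OnePoint K))) ∪ {permU hK ζ hζ})

/-- `M₁₂ = ⟨M₁₁, S₅⟩`. -/
def M12 {K : Type*} [Field K] [DecidableEq K] (hK : Nat.card K = 9) (ζ : K)
    (hζ : ζ ^ 2 = 1 - ζ) : Subgroup (Equiv.Perm (Points K)) :=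
  Subgroup.closure ((M11 hK ζ hζ : Set (Equiv.Perm (Points K))) ∪ {permV hK})

/-! ### The presentation -/

/-- The generating symbols `a, T, J, U, V`. -/
inductive Gen
  | a
  | T
  | J
  | U
  | V

/-- The commutator `[x, y] = x y x⁻¹ y⁻¹`. -/
def comm {G : Type*} [Group G] (x y : G) : G := x * y * x⁻¹ * y⁻¹

/-- The conjugate `x ^ y = y⁻¹ x y`. -/
def conjBy {G : Type*} [Group G] (x y : G) : G := y⁻¹ * x * y

/-- The relators of `M(3²)`: `T² = J² = (JT)³ = (Ta²)³ = [J,a]⁴ = (J[J,a])² = 1`, `a² = [J,a]²`,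
`(aT)² = T ^ [J,a]`. A relation `x = y` is coded as the relator
`x y⁻¹`. -/
def relsM9 (a T J : FreeGroup Gen) : Set (FreeGroup Gen) :=
  {T ^ 2, J ^ 2, (J * T) ^ 3, (T * a ^ 2) ^ 3, (comm J a) ^ 4, (J * (comm J a)) ^ 2,
    a ^ 2 * ((comm J a) ^ 2)⁻¹, (a * T) ^ 2 * (conjBy T (comm J a))⁻¹}

/-- The relators of `M₁₁`: those of `M(3²)`, and
`U² = (UT)² = (UJ)³ = 1`, `a ^ U = [J,a]`. -/
def relsM11 (a T J U : FreeGroup Gen) : Set (FreeGroup Gen) :=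
  relsM9 a T J ∪ {U ^ 2, (U * T) ^ 2, (U * J) ^ 3, conjBy a U * (comm J a)⁻¹}

/-- The relators of `M₁₂`: those of `M₁₁`, and `V² = (VT)² = (VJ)² = (VU)³ = 1`,
`a ^ V = [J,a]⁻¹ a`, `[J,a] ^ V = [J,a]⁻¹`. -/
def relsM12 (a T J U V : FreeGroup Gen) : Set (FreeGroup Gen) :=
  relsM11 a T J U ∪ {V ^ 2, (V * T) ^ 2, (V * J) ^ 2, (V * U) ^ 3,
    conjBy a V * ((comm J a)⁻¹ * a)⁻¹, conjBy (comm J a) V * ((comm J a)⁻¹)⁻¹}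

/-- The abstract group with generating symbols `a, T, J, U, V` and the relators of `M₁₂`. -/
abbrev PresentedM12 : Type :=
  PresentedGroup (relsM12 (FreeGroup.of Gen.a) (FreeGroup.of Gen.T) (FreeGroup.of Gen.J)
    (FreeGroup.of Gen.U) (FreeGroup.of Gen.V))

end Mathieu

/-! Let `b = [J, a]`. In any group satisfying the relations, `⟨a, b⟩` is a quotient of the
quaternion group of order eight, and adjoining `T`, `J`, `U`, `V` in turn gives groups that
decompose into two cells `H ∪ H n H` over the preceding group `H`. For `T` this is read off from the
conjugates `T g T` of the elements `g` of `⟨a, b⟩`, and for the others it follows from the preceding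
decomposition and the braid relation `n s n = s n s` between consecutive generators.

In the action on the twelve points, these generators move `0`, `∞`, `v`, `w` respectively, while
the group below fixes that point, so the cell `H n H` contains no element acting trivially. Hence
the kernel of the action lies in `⟨a, b⟩`. It is trivial, since `a ^ 2` acts nontrivially and some
power of each nontrivial element of the quaternion group is its central involution.

Finally `M(3²)` is generated by `a`, `T` and `J`: the permutations with `r = 0` are products of a
translation and a map `ω ↦ c θ(ω)`, and the others are reduced to these by `J`.
-/

namespace Mathieu

/-! ### Two-cell decompositions and the quaternion group -/

section BruhatCells

variable {G : Type*} [Group G]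

/-- The union `H ∪ H n H` of the two cells of a Bruhat decomposition of rank one. -/
def bruhatCells (H : Subgroup G) (n : G) : Set G :=
  H ∪ DoubleCoset.doubleCoset n H H

theorem mem_bruhatCells {H : Subgroup G} {n g : G} :
    g ∈ bruhatCells H n ↔ g ∈ H ∨ ∃ x ∈ H, ∃ y ∈ H, g = x * n * y := by
  simp only [bruhatCells, Set.mem_union, SetLike.mem_coe, DoubleCoset.mem_doubleCoset]

theorem self_mem_bruhatCells (H : Subgroup G) (n : G) : n ∈ bruhatCells H n :=
  Or.inr (DoubleCoset.mem_doubleCoset_self H H n)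

theorem mul_mem_bruhatCells_left {H : Subgroup G} {n x g : G} (hx : x ∈ H)
    (hg : g ∈ bruhatCells H n) : x * g ∈ bruhatCells H n := by
  rw [mem_bruhatCells] at hg ⊢
  rcases hg with hg | ⟨y, hy, z, hz, rfl⟩
  · exact Or.inl (mul_mem hx hg)
  · exact Or.inr ⟨x * y, mul_mem hx hy, z, hz, by group⟩

theorem mul_mem_bruhatCells_right {H : Subgroup G} {n x g : G} (hg : g ∈ bruhatCells H n)
    (hx : x ∈ H) : g * x ∈ bruhatCells H n := by
  rw [mem_bruhatCells] at hg ⊢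
  rcases hg with hg | ⟨y, hy, z, hz, rfl⟩
  · exact Or.inl (mul_mem hg hx)
  · exact Or.inr ⟨y, hy, z * x, mul_mem hz hx, by group⟩

theorem inv_mem_bruhatCells {H : Subgroup G} {n g : G} (hn : n ^ 2 ∈ H)
    (hg : g ∈ bruhatCells H n) : g⁻¹ ∈ bruhatCells H n := by
  rw [mem_bruhatCells] at hg ⊢
  rcases hg with hg | ⟨y, hy, z, hz, rfl⟩
  · exact Or.inl (inv_mem hg)
  · exact Or.inr ⟨z⁻¹, inv_mem hz, (n ^ 2)⁻¹ * y⁻¹, mul_mem (inv_mem hn) (inv_mem hy), by group⟩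

theorem closure_insert_subset_bruhatCells {S : Set G} {n : G}
    (hn : n ^ 2 ∈ Subgroup.closure S)
    (hconj : ∀ x ∈ Subgroup.closure S, n * x * n ∈ bruhatCells (Subgroup.closure S) n) :
    (Subgroup.closure (insert n S) : Set G) ⊆ bruhatCells (Subgroup.closure S) n := by
  have n_mul_mem : ∀ y ∈ bruhatCells (Subgroup.closure S) n,
      n * y ∈ bruhatCells (Subgroup.closure S) n := by
    intro y hy
    rcases mem_bruhatCells.1 hy with hy | ⟨u, hu, v, hv, rfl⟩
    · exact mul_mem_bruhatCells_right (self_mem_bruhatCells _ n) hy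
    · simpa only [mul_assoc] using mul_mem_bruhatCells_right (hconj u hu) hv
  intro g hg
  induction hg using Subgroup.closure_induction_left with
  | one => exact Or.inl (one_mem _)
  | mul_left x hx y _ ih =>
    rcases hx with rfl | hx
    · exact n_mul_mem y ih
    · exact mul_mem_bruhatCells_left (Subgroup.subset_closure hx) ih
  | inv_mul_cancel x hx y _ ih =>
    rcases hx with rfl | hx
    · rw [show x⁻¹ * y = (x ^ 2)⁻¹ * (x * y) by group]
      exact mul_mem_bruhatCells_left (inv_mem hn) (n_mul_mem y ih)
    · exact mul_mem_bruhatCells_left (inv_mem (Subgroup.subset_closure hx)) ih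

theorem inv_eq_self_of_sq_eq_one {g : G} (hg : g ^ 2 = 1) : g⁻¹ = g :=
  inv_eq_of_mul_eq_one_left (by rw [← sq, hg])

theorem conj_eq_self_of_mul_sq_eq_one {s n : G} (hs : s ^ 2 = 1) (h : (n * s) ^ 2 = 1) :
    n * s * n = s := by
  rw [← inv_eq_self_of_sq_eq_one hs, eq_inv_iff_mul_eq_one, ← h, sq, inv_eq_self_of_sq_eq_one hs]
  group

theorem braid_of_mul_pow_three_eq_one {s n : G} (hs : s ^ 2 = 1) (hn : n ^ 2 = 1)
    (h : (n * s) ^ 3 = 1) : n * s * n = s * n * s := by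
  have hprod : n * s * n * (s * n * s) = 1 := by rw [← h, pow_three]; group
  rw [eq_inv_of_mul_eq_one_left hprod, mul_inv_rev, mul_inv_rev, inv_eq_self_of_sq_eq_one hs,
    inv_eq_self_of_sq_eq_one hn, mul_assoc]

theorem conj_mem_closure {S : Set G} {n : G} (hn : n ^ 2 = 1)
    (hS : ∀ s ∈ S, n * s * n ∈ Subgroup.closure S) {x : G} (hx : x ∈ Subgroup.closure S) :
    n * x * n ∈ Subgroup.closure S := by
  have hn' := inv_eq_self_of_sq_eq_one hn
  have hle : Subgroup.closure S ≤ (Subgroup.closure S).comap (MulAut.conj n).toMonoidHom := by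
    rw [Subgroup.closure_le]
    intro s hs
    simpa [hn'] using hS s hs
  simpa [hn'] using hle hx

/-- Conjugation by `n` keeps `⟨S⟩` in place, so for `x = p s q` with `p, q ∈ ⟨S⟩` the braid relation
`n s n = s n s` carries `n x n` to the cell of `n`. -/
theorem closure_insert_subset_bruhatCells_of_braid {S : Set G} {s n : G}
    (hs : s ^ 2 = 1) (hn : n ^ 2 = 1) (hns : (n * s) ^ 3 = 1)
    (hS : ∀ x ∈ S, n * x * n ∈ Subgroup.closure S)
    (hcells : (Subgroup.closure (insert s S) : Set G) ⊆ bruhatCells (Subgroup.closure S) s) :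
    (Subgroup.closure (insert n (insert s S)) : Set G) ⊆
      bruhatCells (Subgroup.closure (insert s S)) n := by
  have hle : Subgroup.closure S ≤ Subgroup.closure (insert s S) :=
    Subgroup.closure_mono (Set.subset_insert s S)
  have hs_mem : s ∈ Subgroup.closure (insert s S) :=
    Subgroup.subset_closure (Set.mem_insert s S)
  refine closure_insert_subset_bruhatCells (hn ▸ one_mem _) fun x hx => ?_
  rcases mem_bruhatCells.1 (hcells hx) with hx | ⟨p, hp, q, hq, rfl⟩
  · exact Or.inl (hle (conj_mem_closure hn hS hx))
  · have hconj : n * (p * s * q) * n = n * p * n * s * n * (s * (n * q * n)) := by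
      calc n * (p * s * q) * n = n * p * n⁻¹ * (n * s * n) * n⁻¹ * q * n := by group
        _ = n * p * n⁻¹ * (s * n * s) * n⁻¹ * q * n := by
          rw [braid_of_mul_pow_three_eq_one hs hn hns]
        _ = n * p * n * s * n * (s * (n * q * n)) := by
          rw [inv_eq_self_of_sq_eq_one hn]; group
    rw [hconj, mem_bruhatCells]
    exact Or.inr ⟨n * p * n * s, mul_mem (hle (conj_mem_closure hn hS hp)) hs_mem,
      s * (n * q * n), mul_mem hs_mem (hle (conj_mem_closure hn hS hq)), rfl⟩

theorem ker_le_closure_of_subset_bruhatCells {X : Type*} {φ : G →* Equiv.Perm X} {S : Set G}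
    {L : Subgroup G} {n : G} (x : X) (hker : φ.ker ≤ L)
    (hL : (L : Set G) ⊆ bruhatCells (Subgroup.closure S) n)
    (hS : ∀ s ∈ S, φ s x = x) (hn : φ n x ≠ x) : φ.ker ≤ Subgroup.closure S := by
  have hfix : ∀ h ∈ Subgroup.closure S, φ h x = x := by
    have hle : Subgroup.closure S ≤ (MulAction.stabilizer (Equiv.Perm X) x).comap φ :=
      (Subgroup.closure_le _).2 hS
    exact fun h hh => hle hh
  intro g hg
  rcases mem_bruhatCells.1 (hL (hker hg)) with hgS | ⟨y, hy, z, hz, rfl⟩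
  · exact hgS
  · have hyn : φ y (φ n x) = φ y x := by
      calc φ y (φ n x) = φ (y * n * z) x := by simp [hfix z hz]
        _ = φ y x := by rw [MonoidHom.mem_ker.1 hg, hfix y hy, Equiv.Perm.one_apply]
    exact absurd ((φ y).injective hyn) hn

end BruhatCells

section Quaternion

variable {G : Type*} [Group G] {a b : G}

/-- The relations of the quaternion group of order eight, with `a` and `b` in the roles of `i`
and `j`. -/
structure QuaternionRelations (a b : G) : Prop where
  a_pow_four : a ^ 4 = 1
  b_sq : b ^ 2 = a ^ 2
  a_mul_b_mul_a : a * b * a = b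

namespace QuaternionRelations

theorem b_mul_a (Q : QuaternionRelations a b) : b * a = a⁻¹ * b := by
  rw [eq_inv_mul_iff_mul_eq, ← mul_assoc, Q.a_mul_b_mul_a]

theorem a_pow_three (Q : QuaternionRelations a b) : a ^ 3 = a⁻¹ :=
  eq_inv_of_mul_eq_one_left (by rw [← pow_succ, Q.a_pow_four])

theorem a_sq_mul_b (Q : QuaternionRelations a b) : a ^ 2 * b = b⁻¹ :=
  eq_inv_of_mul_eq_one_left (by rw [mul_assoc, ← sq, Q.b_sq, ← pow_add, Q.a_pow_four])

theorem ab_sq (Q : QuaternionRelations a b) : (a * b) ^ 2 = a ^ 2 := by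
  rw [sq, ← mul_assoc, Q.a_mul_b_mul_a, ← sq, Q.b_sq]

theorem a_inv_mul_b (Q : QuaternionRelations a b) : a⁻¹ * b = (a * b)⁻¹ := by
  refine eq_inv_of_mul_eq_one_left ?_
  calc a⁻¹ * b * (a * b) = a⁻¹ ^ 2 * (a * b) ^ 2 := by simp only [sq]; group
    _ = 1 := by rw [Q.ab_sq, inv_pow, inv_mul_cancel]

theorem exists_zpow_of_mem_closure (Q : QuaternionRelations a b) {g : G}
    (hg : g ∈ Subgroup.closure {a, b}) : ∃ i : ℤ, g = a ^ i ∨ g = a ^ i * b := by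
  have b_mul_zpow (i : ℤ) : b * a ^ i = a ^ (-i) * b := by
    have h : SemiconjBy b a a⁻¹ := Q.b_mul_a
    simpa only [inv_zpow'] using (h.zpow_right i).eq
  have hb : b ^ 2 ∈ Subgroup.closure {a} := by
    rw [Q.b_sq]
    exact pow_mem (Subgroup.mem_closure_singleton_self a) 2
  have hcells : (Subgroup.closure {b, a} : Set G) ⊆ bruhatCells (Subgroup.closure {a}) b := by
    refine closure_insert_subset_bruhatCells hb fun x hx => Or.inl ?_
    obtain ⟨i, rfl⟩ := Subgroup.mem_closure_singleton.1 hx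
    rw [b_mul_zpow, mul_assoc, ← sq]
    exact mul_mem (zpow_mem (Subgroup.mem_closure_singleton_self a) _) hb
  rw [Set.pair_comm] at hg
  rcases mem_bruhatCells.1 (hcells hg) with hg | ⟨x, hx, y, hy, rfl⟩
  · obtain ⟨i, rfl⟩ := Subgroup.mem_closure_singleton.1 hg
    exact ⟨i, Or.inl rfl⟩
  · obtain ⟨i, rfl⟩ := Subgroup.mem_closure_singleton.1 hx
    obtain ⟨j, rfl⟩ := Subgroup.mem_closure_singleton.1 hy
    exact ⟨i + -j, Or.inr (by rw [mul_assoc, b_mul_zpow, zpow_add, mul_assoc])⟩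

theorem eq_of_mem_closure (Q : QuaternionRelations a b) {g : G}
    (hg : g ∈ Subgroup.closure {a, b}) :
    g = 1 ∨ g = a ^ 2 ∨ ∃ q ∈ ({a, b, a * b} : Set G), g = q ∨ g = q⁻¹ := by
  have ha : a ^ (4 : ℤ) = 1 := mod_cast Q.a_pow_four
  obtain ⟨i, hi⟩ := Q.exists_zpow_of_mem_closure hg
  rw [zpow_eq_zpow_emod i ha] at hi
  obtain ⟨j, hj, hij⟩ : ∃ j : ℕ, j < 4 ∧ i % 4 = j := ⟨(i % 4).toNat, by omega, by omega⟩
  rw [hij, zpow_natCast] at hi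
  rcases hi with rfl | rfl <;> interval_cases j
  · exact Or.inl (pow_zero a)
  · exact Or.inr (Or.inr ⟨a, by simp, Or.inl (pow_one a)⟩)
  · exact Or.inr (Or.inl rfl)
  · exact Or.inr (Or.inr ⟨a, by simp, Or.inr Q.a_pow_three⟩)
  · exact Or.inr (Or.inr ⟨b, by simp, Or.inl (by rw [pow_zero, one_mul])⟩)
  · exact Or.inr (Or.inr ⟨a * b, by simp, Or.inl (by rw [pow_one])⟩)
  · exact Or.inr (Or.inr ⟨b, by simp, Or.inr Q.a_sq_mul_b⟩)
  · exact Or.inr (Or.inr ⟨a * b, by simp, Or.inr (by rw [Q.a_pow_three, Q.a_inv_mul_b])⟩)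

theorem eq_one_of_mem_closure_of_map_eq_one (Q : QuaternionRelations a b) {G' : Type*} [Group G']
    (φ : G →* G') (ha : φ a ^ 2 ≠ 1) {g : G} (hg : g ∈ Subgroup.closure {a, b})
    (hφ : φ g = 1) : g = 1 := by
  have sq_ne_one (q : G) (hq : q ∈ ({a, b, a * b} : Set G)) : φ q ^ 2 ≠ 1 := by
    rcases hq with rfl | rfl | rfl
    · exact ha
    · rwa [← map_pow, Q.b_sq, map_pow]
    · rwa [← map_pow, Q.ab_sq, map_pow]
  rcases Q.eq_of_mem_closure hg with rfl | rfl | ⟨q, hq, rfl | rfl⟩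
  · rfl
  · exact absurd ((map_pow φ a 2).symm.trans hφ) ha
  · exact absurd (by rw [hφ, one_pow]) (sq_ne_one g hq)
  · rw [map_inv, inv_eq_one] at hφ
    exact absurd (by rw [hφ, one_pow]) (sq_ne_one q hq)

end QuaternionRelations

end Quaternion

/-! ### Groups with the relations of `M₁₂` -/

section Relations

variable {G : Type*} [Group G] {a b T J U V : G}

/-- The relations of `M(3²)` between elements of an arbitrary group, with `b` for `[J, a]`. -/
structure M9Relations (a b T J : G) : Prop where
  comm_eq : comm J a = b
  T_sq : T ^ 2 = 1
  J_sq : J ^ 2 = 1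
  JT : (J * T) ^ 3 = 1
  Ta : (T * a ^ 2) ^ 3 = 1
  b_pow_four : b ^ 4 = 1
  Jb : (J * b) ^ 2 = 1
  a_sq : a ^ 2 = b ^ 2
  aT : (a * T) ^ 2 = conjBy T b

/-- The relations of `M₁₁` between elements of an arbitrary group, with `b` for `[J, a]`. -/
structure M11Relations (a b T J U : G) : Prop extends M9Relations a b T J where
  U_sq : U ^ 2 = 1
  UT : (U * T) ^ 2 = 1
  UJ : (U * J) ^ 3 = 1
  aU : conjBy a U = b

/-- The relations of `M₁₂` between elements of an arbitrary group, with `b` for `[J, a]`. -/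
structure M12Relations (a b T J U V : G) : Prop extends M11Relations a b T J U where
  V_sq : V ^ 2 = 1
  VT : (V * T) ^ 2 = 1
  VJ : (V * J) ^ 2 = 1
  VU : (V * U) ^ 3 = 1
  aV : conjBy a V = b⁻¹ * a
  bV : conjBy b V = b⁻¹

theorem forall_relsM12_map_eq_one_iff (f : FreeGroup Gen →* G) (a T J U V : FreeGroup Gen) :
    (∀ r ∈ relsM12 a T J U V, f r = 1) ↔
      M12Relations (f a) (comm (f J) (f a)) (f T) (f J) (f U) (f V) := by
  simp only [relsM12, relsM11, relsM9, Set.union_insert, Set.union_singleton,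
    Set.forall_mem_insert, Set.mem_singleton_iff, forall_eq, comm, conjBy,
    map_mul, map_pow, map_inv, mul_inv_eq_one]
  constructor
  · rintro ⟨V_sq, VT, VJ, VU, aV, bV, U_sq, UT, UJ, aU, T_sq, J_sq, JT, Ta, b_pow_four, Jb, a_sq,
      aT⟩
    exact { comm_eq := rfl, T_sq, J_sq, JT, Ta, b_pow_four, Jb, a_sq, aT, U_sq, UT, UJ, aU, V_sq,
            VT, VJ, VU, aV, bV }
  · intro R
    exact ⟨R.V_sq, R.VT, R.VJ, R.VU, R.aV, R.bV, R.U_sq, R.UT, R.UJ, R.aU, R.T_sq, R.J_sq, R.JT,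
      R.Ta, R.b_pow_four, R.Jb, R.a_sq, R.aT⟩

namespace M9Relations

theorem J_conj_b (R : M9Relations a b T J) : J * b * J = b⁻¹ :=
  eq_inv_of_mul_eq_one_left (by rw [← R.Jb, sq, mul_assoc])

theorem J_conj_a (R : M9Relations a b T J) : J * a * J = b * a := by
  rw [← R.comm_eq, comm, inv_eq_self_of_sq_eq_one R.J_sq, inv_mul_cancel_right]

theorem quaternionRelations (R : M9Relations a b T J) : QuaternionRelations a b where
  a_pow_four := by rw [show 4 = 2 * 2 from rfl, pow_mul, R.a_sq, ← pow_mul, R.b_pow_four]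
  b_sq := R.a_sq.symm
  a_mul_b_mul_a := by
    have J_conj_sq (x : G) : (J * x * J) ^ 2 = J * x ^ 2 * J := by
      have h := conj_pow (a := J) (b := x) (i := 2)
      rwa [inv_eq_self_of_sq_eq_one R.J_sq] at h
    have hba : (b * a) ^ 2 = b ^ 2 := by
      rw [← R.J_conj_a, J_conj_sq, R.a_sq, ← J_conj_sq, R.J_conj_b, inv_pow, inv_eq_iff_mul_eq_one,
        ← pow_add, R.b_pow_four]
    rw [sq, sq, mul_assoc] at hba
    rw [mul_assoc]
    exact mul_left_cancel hba

theorem T_conj_a (R : M9Relations a b T J) : T * a * T = a⁻¹ * b⁻¹ * T * b := by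
  calc T * a * T = a⁻¹ * (a * T) ^ 2 := by rw [sq]; group
    _ = a⁻¹ * b⁻¹ * T * b := by rw [R.aT, conjBy]; group

theorem T_conj_a_sq (R : M9Relations a b T J) : T * a ^ 2 * T = a ^ 2 * T * a ^ 2 :=
  braid_of_mul_pow_three_eq_one (by rw [← pow_mul, R.quaternionRelations.a_pow_four]) R.T_sq R.Ta

theorem T_conj_b (R : M9Relations a b T J) : T * b * T = b * a * T * a := by
  calc T * b * T = b * conjBy T b * T := by rw [conjBy]; group
    _ = b * a * T * a * T ^ 2 := by rw [← R.aT, sq, sq]; group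
    _ = b * a * T * a := by rw [R.T_sq, mul_one]

theorem T_conj_ab (R : M9Relations a b T J) :
    T * (a * b) * T = a⁻¹ * b⁻¹ * (T * a⁻¹ * T) * a := by
  have hbba : b ^ 2 * a = a⁻¹ := by
    rw [← R.a_sq, ← pow_succ, R.quaternionRelations.a_pow_three]
  calc T * (a * b) * T = (T * a * T) * (T⁻¹ * b * T) := by group
    _ = a⁻¹ * b⁻¹ * (T * (b ^ 2 * a) * T) * a := by
      rw [inv_eq_self_of_sq_eq_one R.T_sq, R.T_conj_b, R.T_conj_a, sq]; group
    _ = a⁻¹ * b⁻¹ * (T * a⁻¹ * T) * a := by rw [hbba]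

theorem T_conj_mem_bruhatCells (R : M9Relations a b T J) {g : G}
    (hg : g ∈ Subgroup.closure {a, b}) :
    T * g * T ∈ bruhatCells (Subgroup.closure {a, b}) T := by
  have ha : a ∈ Subgroup.closure {a, b} := Subgroup.subset_closure (by simp)
  have hb : b ∈ Subgroup.closure {a, b} := Subgroup.subset_closure (by simp)
  have hab : a⁻¹ * b⁻¹ ∈ Subgroup.closure {a, b} := mul_mem (inv_mem ha) (inv_mem hb)
  have sandwich {x y c : G} (hx : x ∈ Subgroup.closure {a, b})
      (hc : c ∈ bruhatCells (Subgroup.closure {a, b}) T) (hy : y ∈ Subgroup.closure {a, b}) :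
      x * c * y ∈ bruhatCells (Subgroup.closure {a, b}) T :=
    mul_mem_bruhatCells_right (mul_mem_bruhatCells_left hx hc) hy
  have hT := self_mem_bruhatCells (Subgroup.closure {a, b}) T
  have inv_conj {q : G} (hq : T * q * T ∈ bruhatCells (Subgroup.closure {a, b}) T) :
      T * q⁻¹ * T ∈ bruhatCells (Subgroup.closure {a, b}) T := by
    have h := inv_mem_bruhatCells (R.T_sq ▸ one_mem _) hq
    rwa [mul_inv_rev, mul_inv_rev, inv_eq_self_of_sq_eq_one R.T_sq, ← mul_assoc] at h
  have hTa : T * a * T ∈ bruhatCells (Subgroup.closure {a, b}) T :=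
    R.T_conj_a ▸ sandwich hab hT hb
  have hTq (q : G) (hq : q ∈ ({a, b, a * b} : Set G)) :
      T * q * T ∈ bruhatCells (Subgroup.closure {a, b}) T := by
    rcases hq with rfl | rfl | rfl
    · exact hTa
    · exact R.T_conj_b ▸ sandwich (mul_mem hb ha) hT ha
    · exact R.T_conj_ab ▸ sandwich hab (inv_conj hTa) ha
  rcases R.quaternionRelations.eq_of_mem_closure hg with rfl | rfl | ⟨q, hq, rfl | rfl⟩
  · exact Or.inl (by rw [mul_one, ← sq, R.T_sq]; exact one_mem _)
  · exact R.T_conj_a_sq ▸ sandwich (pow_mem ha 2) hT (pow_mem ha 2)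
  · exact hTq g hq
  · exact inv_conj (hTq q hq)

theorem closure_T_subset_bruhatCells (R : M9Relations a b T J) :
    (Subgroup.closure {T, a, b} : Set G) ⊆ bruhatCells (Subgroup.closure {a, b}) T :=
  closure_insert_subset_bruhatCells (R.T_sq ▸ one_mem _) fun _ => R.T_conj_mem_bruhatCells

theorem closure_J_subset_bruhatCells (R : M9Relations a b T J) :
    (Subgroup.closure {J, T, a, b} : Set G) ⊆ bruhatCells (Subgroup.closure {T, a, b}) J := by
  refine closure_insert_subset_bruhatCells_of_braid R.T_sq R.J_sq R.JT ?_
    R.closure_T_subset_bruhatCells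
  have ha : a ∈ Subgroup.closure {a, b} := Subgroup.subset_closure (by simp)
  have hb : b ∈ Subgroup.closure {a, b} := Subgroup.subset_closure (by simp)
  rintro s (rfl | rfl)
  · exact R.J_conj_a ▸ mul_mem hb ha
  · exact R.J_conj_b ▸ inv_mem hb

end M9Relations

theorem M11Relations.closure_U_subset_bruhatCells (R : M11Relations a b T J U) :
    (Subgroup.closure {U, J, T, a, b} : Set G) ⊆
      bruhatCells (Subgroup.closure {J, T, a, b}) U := by
  refine closure_insert_subset_bruhatCells_of_braid R.J_sq R.U_sq R.UJ ?_
    R.closure_J_subset_bruhatCells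
  have U_conj_a : U * a * U = b := by
    rw [← R.aU, conjBy, inv_eq_self_of_sq_eq_one R.U_sq]
  have U_conj_b : U * b * U = a := by
    rw [← R.aU, conjBy]; simp [mul_assoc, ← sq, R.U_sq]
  rintro s (rfl | rfl | rfl)
  · rw [conj_eq_self_of_mul_sq_eq_one R.T_sq R.UT]; exact Subgroup.subset_closure (by simp)
  · rw [U_conj_a]; exact Subgroup.subset_closure (by simp)
  · rw [U_conj_b]; exact Subgroup.subset_closure (by simp)

namespace M12Relations

theorem closure_V_subset_bruhatCells (R : M12Relations a b T J U V) :
    (Subgroup.closure {V, U, J, T, a, b} : Set G) ⊆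
      bruhatCells (Subgroup.closure {U, J, T, a, b}) V := by
  refine closure_insert_subset_bruhatCells_of_braid R.U_sq R.V_sq R.VU ?_
    R.closure_U_subset_bruhatCells
  have V_conj (x : G) : V * x * V = conjBy x V := by
    rw [conjBy, inv_eq_self_of_sq_eq_one R.V_sq]
  have ha : a ∈ Subgroup.closure {J, T, a, b} := Subgroup.subset_closure (by simp)
  have hb : b ∈ Subgroup.closure {J, T, a, b} := Subgroup.subset_closure (by simp)
  rintro s (rfl | rfl | rfl | rfl)
  · rw [conj_eq_self_of_mul_sq_eq_one R.J_sq R.VJ]; exact Subgroup.subset_closure (by simp)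
  · rw [conj_eq_self_of_mul_sq_eq_one R.T_sq R.VT]; exact Subgroup.subset_closure (by simp)
  · rw [V_conj, R.aV]; exact mul_mem (inv_mem hb) ha
  · rw [V_conj, R.bV]; exact inv_mem hb

/-- The points `p0, pinf, pv, pw` play the roles of `0, ∞, v, w`. -/
theorem injective_of_points (R : M12Relations a b T J U V)
    (hG : Subgroup.closure {V, U, J, T, a, b} = ⊤) {X : Type*} (φ : G →* Equiv.Perm X)
    {p0 pinf pv pw : X} (ha : φ a ^ 2 ≠ 1)
    (h0 : ∀ s ∈ ({a, b} : Set G), φ s p0 = p0) (hT : φ T p0 ≠ p0)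
    (hinf : ∀ s ∈ ({T, a, b} : Set G), φ s pinf = pinf) (hJ : φ J pinf ≠ pinf)
    (hv : ∀ s ∈ ({J, T, a, b} : Set G), φ s pv = pv) (hU : φ U pv ≠ pv)
    (hw : ∀ s ∈ ({U, J, T, a, b} : Set G), φ s pw = pw) (hV : φ V pw ≠ pw) :
    Function.Injective φ := by
  have ker_le_U : φ.ker ≤ Subgroup.closure {U, J, T, a, b} :=
    ker_le_closure_of_subset_bruhatCells pw (le_top.trans_eq hG.symm)
      R.closure_V_subset_bruhatCells hw hV
  have ker_le_J : φ.ker ≤ Subgroup.closure {J, T, a, b} :=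
    ker_le_closure_of_subset_bruhatCells pv ker_le_U R.closure_U_subset_bruhatCells hv hU
  have ker_le_T : φ.ker ≤ Subgroup.closure {T, a, b} :=
    ker_le_closure_of_subset_bruhatCells pinf ker_le_J R.closure_J_subset_bruhatCells hinf hJ
  have ker_le_Q : φ.ker ≤ Subgroup.closure {a, b} :=
    ker_le_closure_of_subset_bruhatCells p0 ker_le_T R.closure_T_subset_bruhatCells h0 hT
  exact (injective_iff_map_eq_one φ).2 fun g hg =>
    R.quaternionRelations.eq_one_of_mem_closure_of_map_eq_one φ ha (ker_le_Q hg) hg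

end M12Relations

end Relations

/-! ### The action on the twelve points -/

section Table

/-- The generators as permutations of twelve numbers: `0, …, 7` stand for the exponents of the
powers of `ζ`, and `8, 9, 10, 11` for the points `0, ∞, v, w`. -/
def table : Gen → Equiv.Perm (Fin 12)
  | .a =>
    { toFun := ![7, 2, 5, 0, 3, 6, 1, 4, 8, 9, 10, 11]
      invFun := ![3, 6, 1, 4, 7, 2, 5, 0, 8, 9, 10, 11]
      left_inv := by decide
      right_inv := by decide }
  | .T => Function.Involutive.toPerm ![8, 2, 1, 6, 4, 7, 3, 5, 0, 9, 10, 11]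
      (show ∀ i, _ by decide)
  | .J => Function.Involutive.toPerm ![0, 7, 6, 5, 4, 3, 2, 1, 9, 8, 10, 11]
      (show ∀ i, _ by decide)
  | .U => Function.Involutive.toPerm ![0, 5, 7, 6, 4, 1, 3, 2, 8, 10, 9, 11]
      (show ∀ i, _ by decide)
  | .V => Function.Involutive.toPerm ![0, 3, 6, 1, 4, 7, 2, 5, 8, 9, 11, 10]
      (show ∀ i, _ by decide)

theorem m12Relations_table :
    M12Relations (table .a) (comm (table .J) (table .a)) (table .T) (table .J) (table .U)
      (table .V) := by
  refine ⟨⟨⟨rfl, ?_, ?_, ?_, ?_, ?_, ?_, ?_, ?_⟩, ?_, ?_, ?_, ?_⟩, ?_, ?_, ?_, ?_, ?_, ?_⟩ <;>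
  · ext i
    revert i
    decide

theorem m12Relations_presentedM12 :
    M12Relations (G := PresentedM12) (PresentedGroup.of .a)
      (comm (PresentedGroup.of .J) (PresentedGroup.of .a)) (PresentedGroup.of .T)
      (PresentedGroup.of .J) (PresentedGroup.of .U) (PresentedGroup.of .V) :=
  (forall_relsM12_map_eq_one_iff (PresentedGroup.mk _) ..).1 fun _ => PresentedGroup.one_of_mem

/-- The action of the presented group on twelve numbers given by `table`. -/
def tableHom : PresentedM12 →* Equiv.Perm (Fin 12) :=
  PresentedGroup.toGroup ((forall_relsM12_map_eq_one_iff (FreeGroup.lift table) ..).2 (by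
    simpa only [FreeGroup.lift_apply_of] using m12Relations_table))

theorem tableHom_of (g : Gen) : tableHom (PresentedGroup.of g) = table g :=
  PresentedGroup.toGroup.of _

theorem tableHom_injective : Function.Injective tableHom := by
  refine m12Relations_presentedM12.injective_of_points ?_ tableHom
    (p0 := 8) (pinf := 9) (pv := 10) (pw := 11) ?_ ?_ ?_ ?_ ?_ ?_ ?_ ?_ ?_
  · rw [eq_top_iff, ← PresentedGroup.closure_range_of]
    refine Subgroup.closure_mono ?_
    rintro _ ⟨g, rfl⟩
    cases g <;> simp
  all_goals
    simp only [comm, Set.mem_insert_iff, Set.mem_singleton_iff, forall_eq_or_imp, forall_eq,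
      map_mul, map_inv, tableHom_of]
    decide

end Table

section Field

variable {K : Type*} [Field K]

theorem zeta_ne_zero {ζ : K} (hζ : ζ ^ 2 = 1 - ζ) : ζ ≠ 0 := by
  rintro rfl
  norm_num at hζ

theorem pow_nine (hK : Nat.card K = 9) (x : K) : x ^ 9 = x := by
  have h : (x ^ 3) ^ 3 = x := (cubePerm hK).left_inv x
  rwa [← pow_mul] at h

theorem pow_eight (hK : Nat.card K = 9) {x : K} (hx : x ≠ 0) : x ^ 8 = 1 :=
  mul_right_cancel₀ hx (by rw [← pow_succ, pow_nine hK, one_mul])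

theorem neg_one_ne_one (hK : Nat.card K = 9) : (-1 : K) ≠ 1 := fun h =>
  one_ne_zero (α := K) (by linear_combination three_eq_zero hK + h)

theorem zeta_pow_four (hK : Nat.card K = 9) {ζ : K} (hζ : ζ ^ 2 = 1 - ζ) : ζ ^ 4 = -1 := by
  linear_combination (ζ ^ 2 + 2 - ζ) * hζ + (1 - ζ) * three_eq_zero hK

theorem isPrimitiveRoot_zeta (hK : Nat.card K = 9) {ζ : K} (hζ : ζ ^ 2 = 1 - ζ) :
    IsPrimitiveRoot ζ 8 :=
  IsPrimitiveRoot.iff_orderOf.2 <| orderOf_eq_prime_pow (p := 2) (n := 2)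
    (fun h => neg_one_ne_one hK ((zeta_pow_four hK hζ).symm.trans h))
    (pow_eight hK (zeta_ne_zero hζ))

theorem exists_zeta_pow_eq (hK : Nat.card K = 9) {ζ : K} (hζ : ζ ^ 2 = 1 - ζ) {x : K}
    (hx : x ≠ 0) : ∃ i < 8, ζ ^ i = x :=
  (isPrimitiveRoot_zeta hK hζ).eq_pow_of_pow_eq_one (pow_eight hK hx)

theorem isSquare_neg_one (hK : Nat.card K = 9) {ζ : K} (hζ : ζ ^ 2 = 1 - ζ) :
    IsSquare (-1 : K) :=
  ⟨ζ ^ 2, by rw [← zeta_pow_four hK hζ]; ring⟩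

theorem not_isSquare_zeta_inv (hK : Nat.card K = 9) {ζ : K} (hζ : ζ ^ 2 = 1 - ζ) :
    ¬ IsSquare ζ⁻¹ := by
  rintro ⟨d, hd⟩
  have hd0 : d ≠ 0 := by
    rintro rfl
    exact inv_ne_zero (zeta_ne_zero hζ) (hd.trans (zero_mul 0))
  apply neg_one_ne_one hK
  calc (-1 : K) = (ζ⁻¹ ^ 4)⁻¹ := by rw [inv_pow, inv_inv, zeta_pow_four hK hζ]
    _ = (d ^ 8)⁻¹ := by rw [hd]; ring
    _ = 1 := by rw [pow_eight hK hd0, inv_one]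

end Field

section Numbering

variable {K : Type*}

theorem card_newPoint : Nat.card NewPoint = 2 := by
  have h (p : NewPoint) : p ∈ ({.v, .w} : Set NewPoint) := by cases p <;> simp
  rw [← Set.ncard_univ, ← Set.eq_univ_of_forall h, Set.ncard_pair (by simp)]

theorem card_points (hK : Nat.card K = 9) : Nat.card (Points K) = 12 := by
  have : Finite K := Nat.finite_of_card_ne_zero (by omega)
  have : Finite NewPoint := Nat.finite_of_card_ne_zero (by rw [card_newPoint]; omega)
  have : Finite (OnePoint K) := inferInstanceAs (Finite (Option K))
  have card_onePoint : Nat.card (OnePoint K) = Nat.card K + 1 := Finite.card_option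
  rw [Nat.card_sum, card_newPoint, card_onePoint, hK]

theorem extend_affinePerm_coe {e : Equiv.Perm K} {x y : K} (h : e x = y) :
    extend (affinePerm e) (.inl x) = .inl (y : OnePoint K) :=
  congrArg (fun z : K => (.inl z : Points K)) h

variable [Field K]

/-- The point with a given number, in the numbering used by `table`. -/
def point (ζ : K) : Fin 12 → Points K :=
  ![.inl ↑(ζ ^ 0), .inl ↑(ζ ^ 1), .inl ↑(ζ ^ 2), .inl ↑(ζ ^ 3), .inl ↑(ζ ^ 4), .inl ↑(ζ ^ 5),
    .inl ↑(ζ ^ 6), .inl ↑(ζ ^ 7), .inl ↑(0 : K), .inl ∞, .inr .v, .inr .w]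

theorem point_surjective (hK : Nat.card K = 9) {ζ : K} (hζ : ζ ^ 2 = 1 - ζ) :
    Function.Surjective (point ζ) := by
  rintro (p | _ | _)
  · cases p with
    | infty => exact ⟨9, rfl⟩
    | coe x =>
      rcases eq_or_ne x 0 with rfl | hx
      · exact ⟨8, rfl⟩
      · obtain ⟨i, hi, rfl⟩ := exists_zeta_pow_eq hK hζ hx
        refine ⟨⟨i, by omega⟩, ?_⟩
        interval_cases i <;> rfl
  · exact ⟨10, rfl⟩
  · exact ⟨11, rfl⟩

/-- The numbering of the twelve points as a bijection. -/
noncomputable def pointEquiv (hK : Nat.card K = 9) (ζ : K) (hζ : ζ ^ 2 = 1 - ζ) :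
    Fin 12 ≃ Points K :=
  Equiv.ofBijective (point ζ) <| by
    have : Finite (Points K) := Nat.finite_of_card_ne_zero (by rw [card_points hK]; omega)
    exact (point_surjective hK hζ).bijective_of_nat_card_le (by simp [card_points hK])

/-- The permutation representation of the presented group on the twelve points. -/
noncomputable def permHom (hK : Nat.card K = 9) (ζ : K) (hζ : ζ ^ 2 = 1 - ζ) :
    PresentedM12 →* Equiv.Perm (Points K) :=
  (pointEquiv hK ζ hζ).permCongrHom.toMonoidHom.comp tableHom

theorem permHom_injective (hK : Nat.card K = 9) (ζ : K) (hζ : ζ ^ 2 = 1 - ζ) :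
    Function.Injective (permHom hK ζ hζ) :=
  (pointEquiv hK ζ hζ).permCongrHom.injective.comp tableHom_injective

theorem permA_point (hK : Nat.card K = 9) {ζ : K} (hζ : ζ ^ 2 = 1 - ζ) (i : Fin 12) :
    extend (permA hK ζ hζ) (point ζ i) = point ζ (table .a i) := by
  have h8 := pow_eight hK (zeta_ne_zero hζ)
  have permA_coe {x y : K} (h : x ^ 3 = ζ * y) :
      extend (permA hK ζ hζ) (.inl x) = .inl (y : OnePoint K) :=
    extend_affinePerm_coe ((inv_mul_eq_iff_eq_mul₀ (zeta_ne_zero hζ)).2 h)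
  fin_cases i
  iterate 9 refine permA_coe ?_; grind
  all_goals rfl

theorem permT_point (hK : Nat.card K = 9) {ζ : K} (hζ : ζ ^ 2 = 1 - ζ) (i : Fin 12) :
    extend permT (point ζ i) = point ζ (table .T i) := by
  have h3 := three_eq_zero hK
  have permT_coe {x y : K} (h : 1 - x = y) :
      extend permT (.inl x) = .inl (y : OnePoint K) := extend_affinePerm_coe h
  fin_cases i
  iterate 9 refine permT_coe ?_; grind
  all_goals rfl

theorem permV_point (hK : Nat.card K = 9) {ζ : K} (hζ : ζ ^ 2 = 1 - ζ) (i : Fin 12) :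
    permV hK (point ζ i) = point ζ (table .V i) := by
  have h8 := pow_eight hK (zeta_ne_zero hζ)
  have permV_coe {x y : K} (h : x ^ 3 = y) :
      permV hK (.inl x) = .inl (y : OnePoint K) :=
    extend_affinePerm_coe (e := cubePerm hK) h
  fin_cases i
  iterate 9 refine permV_coe ?_; grind
  all_goals rfl

theorem permU_point (hK : Nat.card K = 9) {ζ : K} (hζ : ζ ^ 2 = 1 - ζ) (i : Fin 12) :
    permU hK ζ hζ (point ζ i) = point ζ (table .U i) := by
  have h3 := three_eq_zero hK
  have permU_coe {x y : K} (h : (ζ - 1) * x - (1 + ζ) * x ^ 3 = y) :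
      permU hK ζ hζ (.inl x) = .inl (y : OnePoint K) :=
    extend_affinePerm_coe (e := conjPerm hK ζ hζ) h
  fin_cases i
  iterate 9 refine permU_coe ?_; grind
  all_goals rfl

variable [DecidableEq K]

theorem permJ_zero : permJ ((0 : K) : OnePoint K) = ∞ :=
  if_pos rfl

theorem permJ_infty : permJ (∞ : OnePoint K) = ((0 : K) : OnePoint K) :=
  rfl

theorem permJ_coe {x : K} (hx : x ≠ 0) : permJ (x : OnePoint K) = ((x⁻¹ : K) : OnePoint K) :=
  if_neg hx

theorem permJ_point (hK : Nat.card K = 9) {ζ : K} (hζ : ζ ^ 2 = 1 - ζ) (i : Fin 12) :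
    extend permJ (point ζ i) = point ζ (table .J i) := by
  have h8 := pow_eight hK (zeta_ne_zero hζ)
  have extend_permJ_coe {x y : K} (h : x * y = 1) :
      extend permJ (.inl x) = .inl (y : OnePoint K) := by
    rw [← inv_eq_of_mul_eq_one_right h]
    exact congrArg Sum.inl (permJ_coe (left_ne_zero_of_mul_eq_one h))
  fin_cases i
  iterate 8 refine extend_permJ_coe ?_; grind
  · exact congrArg Sum.inl permJ_zero
  all_goals rfl

/-- The permutation of the twelve points denoted by a generating symbol. -/
def perm (hK : Nat.card K = 9) (ζ : K) (hζ : ζ ^ 2 = 1 - ζ) : Gen → Equiv.Perm (Points K)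
  | .a => extend (permA hK ζ hζ)
  | .T => extend permT
  | .J => extend permJ
  | .U => permU hK ζ hζ
  | .V => permV hK

theorem permCongr_table (hK : Nat.card K = 9) (ζ : K) (hζ : ζ ^ 2 = 1 - ζ) (g : Gen) :
    (pointEquiv hK ζ hζ).permCongr (table g) = perm hK ζ hζ g := by
  ext p
  obtain ⟨i, rfl⟩ := (pointEquiv hK ζ hζ).surjective p
  rw [Equiv.permCongr_apply, Equiv.symm_apply_apply]
  cases g
  · exact (permA_point hK hζ i).symm
  · exact (permT_point hK hζ i).symm
  · exact (permJ_point hK hζ i).symm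
  · exact (permU_point hK hζ i).symm
  · exact (permV_point hK hζ i).symm

theorem permHom_of (hK : Nat.card K = 9) (ζ : K) (hζ : ζ ^ 2 = 1 - ζ) (g : Gen) :
    permHom hK ζ hζ (PresentedGroup.of g) = perm hK ζ hζ g := by
  rw [← permCongr_table, ← tableHom_of]
  rfl

theorem range_permHom (hK : Nat.card K = 9) (ζ : K) (hζ : ζ ^ 2 = 1 - ζ) :
    (permHom hK ζ hζ).range = Subgroup.closure (Set.range (perm hK ζ hζ)) := by
  rw [MonoidHom.range_eq_map, ← PresentedGroup.closure_range_of, MonoidHom.map_closure,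
    ← Set.range_comp]
  exact congrArg (fun f => Subgroup.closure (Set.range f)) (funext (permHom_of hK ζ hζ))

end Numbering

/-! ### Generators of `M(3²)` -/

section Zassenhaus

variable {K : Type*}

theorem affinePerm_one : affinePerm (1 : Equiv.Perm K) = 1 := by
  ext p
  cases p <;> rfl

theorem affinePerm_mul (e f : Equiv.Perm K) :
    affinePerm (e * f) = affinePerm e * affinePerm f := by
  ext p
  cases p <;> rfl

variable [Field K] {hK : Nat.card K = 9} {ζ : K} {hζ : ζ ^ 2 = 1 - ζ}

/-- The automorphism `ω ↦ ω ^ 3` of a field with nine elements. -/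
def cubeEquiv (hK : Nat.card K = 9) : K ≃+* K where
  __ := cubePerm hK
  map_mul' x y := mul_pow x y 3
  map_add' x y := show (x + y) ^ 3 = x ^ 3 + y ^ 3 by
    linear_combination (x ^ 2 * y + x * y ^ 2) * three_eq_zero hK

open Classical in
/-- The automorphism `θ` attached to `Δ = c` in the definition of `M(3²)`: the identity if `c` is a
square, and `ω ↦ ω ^ 3` otherwise. -/
noncomputable def twist (hK : Nat.card K = 9) (c : K) : K ≃+* K :=
  if IsSquare c then RingEquiv.refl K else cubeEquiv hK

theorem twist_of_isSquare {c : K} (hc : IsSquare c) : twist hK c = RingEquiv.refl K :=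
  if_pos hc

theorem twist_of_not_isSquare {c : K} (hc : ¬ IsSquare c) : twist hK c = cubeEquiv hK :=
  if_neg hc

theorem twist_mul_of_isSquare {c d : K} (hd : IsSquare d) (hd0 : d ≠ 0) :
    twist hK (c * d) = twist hK c := by
  by_cases hc : IsSquare c
  · rw [twist_of_isSquare hc, twist_of_isSquare (hc.mul hd)]
  · have hcd : ¬ IsSquare (c * d) := fun h =>
      hc (by simpa only [mul_div_cancel_right₀ c hd0] using h.div hd)
    rw [twist_of_not_isSquare hc, twist_of_not_isSquare hcd]

/-- The permutation `ω ↦ c θ(ω)`, where `θ` is attached to `c`. -/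
noncomputable def twistedDilation (hK : Nat.card K = 9) (c : K) (hc : c ≠ 0) :
    Equiv.Perm (OnePoint K) :=
  affinePerm (Equiv.mulLeft₀ c hc * (twist hK c).toEquiv)

theorem isSquare_zeta_mul (hK : Nat.card K = 9) (hζ : ζ ^ 2 = 1 - ζ) {c : K}
    (hc : ¬ IsSquare c) : IsSquare (ζ * c) := by
  have hc0 : c ≠ 0 := by
    rintro rfl
    exact hc IsSquare.zero
  obtain ⟨i, -, rfl⟩ := exists_zeta_pow_eq hK hζ hc0
  rw [← pow_succ']
  refine Even.isSquare_pow ?_ ζ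
  rw [Nat.even_add_one]
  exact fun hi => hc (hi.isSquare_pow ζ)

variable [DecidableEq K]

/-- The permutation `ω ↦ (p θ(ω) + q) / (r θ(ω) + s)` defined by a matrix with rows `(p, q)` and
`(r, s)`, where `θ` is attached to the determinant. -/
noncomputable def zassenhausPerm (hK : Nat.card K = 9) (A : GL (Fin 2) K) :
    Equiv.Perm (OnePoint K) :=
  MulAction.toPerm A * affinePerm (twist hK (A : Matrix (Fin 2) (Fin 2) K).det).toEquiv

theorem zassenhaus_eq_closure_range :
    zassenhaus hK = Subgroup.closure (Set.range (zassenhausPerm hK)) := by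
  refine congrArg Subgroup.closure (Set.ext fun h => exists_congr fun A => ?_)
  rw [eq_comm, Equiv.ext_iff, zassenhausPerm]
  by_cases hA : IsSquare (A : Matrix (Fin 2) (Fin 2) K).det
  · have affinePerm_refl : affinePerm (RingEquiv.refl K).toEquiv = 1 := affinePerm_one
    simp only [hA, true_and, not_true, false_and, or_false, twist_of_isSquare, affinePerm_refl,
      mul_one, MulAction.toPerm_apply]
  · simp only [hA, false_and, not_false_eq_true, true_and, false_or, twist_of_not_isSquare]
    rfl

theorem zassenhausPerm_infty (A : GL (Fin 2) K) :
    zassenhausPerm hK A ∞ = if A 1 0 = 0 then ∞ else ↑(A 0 0 / A 1 0) :=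
  OnePoint.smul_infty_eq_ite A

theorem zassenhausPerm_coe (A : GL (Fin 2) K) (x : K) {θ : K ≃+* K}
    (hθ : twist hK (A : Matrix (Fin 2) (Fin 2) K).det = θ) :
    zassenhausPerm hK A x = if A 1 0 * θ x + A 1 1 = 0 then ∞
      else ↑((A 0 0 * θ x + A 0 1) / (A 1 0 * θ x + A 1 1)) := by
  subst hθ
  exact OnePoint.smul_some_eq_ite

theorem mem_zassenhaus {p q r s : K} (hdet : p * s - q * r ≠ 0) {θ : K ≃+* K}
    (hθ : twist hK (p * s - q * r) = θ) {h : Equiv.Perm (OnePoint K)}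
    (h_infty : h ∞ = if r = 0 then ∞ else ↑(p / r))
    (h_coe : ∀ x : K, h x = if r * θ x + s = 0 then ∞ else ↑((p * θ x + q) / (r * θ x + s))) :
    h ∈ zassenhaus hK := by
  rw [← Matrix.det_fin_two_of] at hdet hθ
  let A : GL (Fin 2) K := Matrix.GeneralLinearGroup.mkOfDetNeZero !![p, q; r, s] hdet
  have hA : zassenhausPerm hK A = h := by
    ext ω
    cases ω with
    | infty => exact (zassenhausPerm_infty A).trans h_infty.symm
    | coe x => exact (zassenhausPerm_coe A x hθ).trans (h_coe x).symm
  rw [zassenhaus_eq_closure_range]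
  exact Subgroup.subset_closure ⟨A, hA⟩

theorem permA_mem_zassenhaus (hK : Nat.card K = 9) (hζ : ζ ^ 2 = 1 - ζ) :
    permA hK ζ hζ ∈ zassenhaus hK := by
  have det_eq : ζ⁻¹ * 1 - 0 * 0 = ζ⁻¹ := by ring
  have htwist : twist hK (ζ⁻¹ * 1 - 0 * 0) = cubeEquiv hK := by
    rw [det_eq, twist_of_not_isSquare (not_isSquare_zeta_inv hK hζ)]
  refine mem_zassenhaus (by rw [det_eq]; exact inv_ne_zero (zeta_ne_zero hζ)) htwist
    (if_pos rfl).symm fun x => ?_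
  simp only [zero_mul, zero_add, one_ne_zero, if_false, add_zero, div_one]
  rfl

theorem permT_mem_zassenhaus (hK : Nat.card K = 9) (hζ : ζ ^ 2 = 1 - ζ) :
    permT ∈ zassenhaus hK := by
  have det_eq : (-1 : K) * 1 - 1 * 0 = -1 := by ring
  have htwist : twist hK ((-1 : K) * 1 - 1 * 0) = RingEquiv.refl K := by
    rw [det_eq, twist_of_isSquare (isSquare_neg_one hK hζ)]
  refine mem_zassenhaus (by rw [det_eq]; exact neg_ne_zero.2 one_ne_zero) htwist
    (if_pos rfl).symm fun x => ?_
  simp only [zero_mul, zero_add, one_ne_zero, if_false, div_one, neg_one_mul, neg_add_eq_sub]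
  rfl

theorem permJ_mem_zassenhaus (hK : Nat.card K = 9) (hζ : ζ ^ 2 = 1 - ζ) :
    permJ ∈ zassenhaus hK := by
  have det_eq : (0 : K) * 0 - 1 * 1 = -1 := by ring
  have htwist : twist hK ((0 : K) * 0 - 1 * 1) = RingEquiv.refl K := by
    rw [det_eq, twist_of_isSquare (isSquare_neg_one hK hζ)]
  refine mem_zassenhaus (by rw [det_eq]; exact neg_ne_zero.2 one_ne_zero) htwist ?_ fun x => ?_
  · rw [permJ_infty, if_neg one_ne_zero, zero_div]
  · simp only [zero_mul, zero_add, one_mul, add_zero, one_div]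
    rfl

variable {S : Subgroup (Equiv.Perm (OnePoint K))}

theorem permJ_mul_permA_mul_permJ :
    permJ * permA hK ζ hζ * permJ =
      affinePerm (Equiv.mulLeft₀ (ζ ^ 2) (pow_ne_zero 2 (zeta_ne_zero hζ))) * permA hK ζ hζ := by
  have hζ0 := zeta_ne_zero hζ
  have permA_coe (x : K) : permA hK ζ hζ x = ((ζ⁻¹ * x ^ 3 : K) : OnePoint K) := rfl
  ext p
  simp only [Equiv.Perm.mul_apply]
  cases p with
  | infty =>
    rw [permJ_infty, permA_coe, zero_pow three_ne_zero, mul_zero, permJ_zero]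
    rfl
  | coe x =>
    rw [permA_coe]
    rcases eq_or_ne x 0 with rfl | hx
    · rw [permJ_zero, zero_pow three_ne_zero, mul_zero]
      exact congrArg _ (mul_zero (ζ ^ 2)).symm
    · rw [permJ_coe hx, permA_coe, permJ_coe (by positivity)]
      refine congrArg _ (?_ : _ = ζ ^ 2 * (ζ⁻¹ * x ^ 3))
      field_simp

theorem dilation_mem (hA : permA hK ζ hζ ∈ S) (hJ : permJ ∈ S) {c : K} (hsq : IsSquare c)
    (hc : c ≠ 0) : affinePerm (Equiv.mulLeft₀ c hc) ∈ S := by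
  have hζ0 := zeta_ne_zero hζ
  have base : affinePerm (Equiv.mulLeft₀ (ζ ^ 2) (pow_ne_zero 2 hζ0)) ∈ S := by
    rw [← S.mul_mem_cancel_right hA, ← permJ_mul_permA_mul_permJ]
    exact S.mul_mem (S.mul_mem hJ hA) hJ
  have powers (i : ℕ) : affinePerm (Equiv.mulLeft₀ ((ζ ^ 2) ^ i) (by positivity)) ∈ S := by
    induction i with
    | zero =>
      convert S.one_mem
      rw [← affinePerm_one]
      exact congrArg affinePerm (Equiv.ext fun x => (by simp))
    | succ i ih =>
      convert S.mul_mem base ih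
      rw [← affinePerm_mul]
      refine congrArg affinePerm (Equiv.ext fun x => ?_)
      simp [pow_succ', mul_assoc]
  obtain ⟨d, rfl⟩ := hsq
  obtain ⟨i, -, rfl⟩ := exists_zeta_pow_eq hK hζ (left_ne_zero_of_mul hc)
  simpa only [← pow_mul, mul_comm 2, ← sq] using powers i

theorem twistedDilation_mem (hA : permA hK ζ hζ ∈ S) (hJ : permJ ∈ S) {c : K} (hc : c ≠ 0) :
    twistedDilation hK c hc ∈ S := by
  by_cases hsq : IsSquare c
  · rw [twistedDilation, twist_of_isSquare hsq]
    exact dilation_mem hA hJ hsq hc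
  · have hζ0 := zeta_ne_zero hζ
    convert S.mul_mem (dilation_mem hA hJ (isSquare_zeta_mul hK hζ hsq) (mul_ne_zero hζ0 hc)) hA
    rw [twistedDilation, twist_of_not_isSquare hsq, permA, ← affinePerm_mul]
    refine congrArg affinePerm (Equiv.ext fun x => (?_ : c * x ^ 3 = ζ * c * (ζ⁻¹ * x ^ 3)))
    field_simp

theorem translation_mem (hA : permA hK ζ hζ ∈ S) (hT : permT ∈ S) (hJ : permJ ∈ S) (c : K) :
    affinePerm (Equiv.addRight c) ∈ S := by
  rcases eq_or_ne c 0 with rfl | hc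
  · rw [Equiv.addRight_zero]
    exact affinePerm_one (K := K) ▸ S.one_mem
  have hneg : (-1 : K) ≠ 0 := neg_ne_zero.2 one_ne_zero
  have hc_mem := twistedDilation_mem hA hJ hc
  have conj_eq : affinePerm (Equiv.addRight c) * twistedDilation hK c hc =
      twistedDilation hK c hc * (permT * twistedDilation hK (-1) hneg) := by
    simp only [twistedDilation, permT, ← affinePerm_mul,
      twist_of_isSquare (isSquare_neg_one hK hζ)]
    refine congrArg affinePerm (Equiv.ext fun x =>
      (?_ : c * twist hK c x + c = c * twist hK c (1 - -1 * x)))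
    rw [neg_one_mul, sub_neg_eq_add, map_add, map_one, mul_add, mul_one, add_comm]
  rw [← S.mul_mem_cancel_right hc_mem, conj_eq]
  exact S.mul_mem hc_mem (S.mul_mem hT (twistedDilation_mem hA hJ hneg))

theorem zassenhausPerm_eq_of_lower_left_eq_zero {A : GL (Fin 2) K} (hr : A 1 0 = 0)
    (hp : A 0 0 ≠ 0) (hs : A 1 1 ≠ 0) :
    zassenhausPerm hK A =
      affinePerm (Equiv.addRight (A 0 1 / A 1 1)) *
        twistedDilation hK (A 0 0 / A 1 1) (div_ne_zero hp hs) := by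
  have htwist :
      twist hK (A : Matrix (Fin 2) (Fin 2) K).det = twist hK (A 0 0 / A 1 1) := by
    rw [← twist_mul_of_isSquare (c := A 0 0 / A 1 1) (IsSquare.mul_self (A 1 1))
      (mul_ne_zero hs hs), Matrix.det_fin_two, hr]
    congr 1
    field_simp
    ring
  ext p
  cases p with
  | infty => rw [zassenhausPerm_infty, if_pos hr]; rfl
  | coe x =>
    rw [zassenhausPerm_coe A x htwist, hr, zero_mul, zero_add, if_neg hs, add_div,
      mul_div_right_comm]
    rfl

theorem zassenhausPerm_eq_of_lower_left_ne_zero {A B : GL (Fin 2) K} (hr : A 1 0 ≠ 0)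
    (hB : (B : Matrix (Fin 2) (Fin 2) K) = !![A 1 0, A 1 1; 0, A 0 1 - A 0 0 * A 1 1 / A 1 0])
    (hsq : IsSquare (-1 : K)) :
    zassenhausPerm hK A =
      affinePerm (Equiv.addRight (A 0 0 / A 1 0)) * permJ * zassenhausPerm hK B := by
  have hB00 : B 0 0 = A 1 0 := by rw [hB]; rfl
  have hB01 : B 0 1 = A 1 1 := by rw [hB]; rfl
  have hB10 : B 1 0 = 0 := by rw [hB]; rfl
  have hB11 : B 1 1 = A 0 1 - A 0 0 * A 1 1 / A 1 0 := by rw [hB]; rfl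
  have htwist : twist hK (A : Matrix (Fin 2) (Fin 2) K).det =
      twist hK (B : Matrix (Fin 2) (Fin 2) K).det := by
    rw [← twist_mul_of_isSquare hsq (neg_ne_zero.2 one_ne_zero), hB, Matrix.det_fin_two_of,
      Matrix.det_fin_two]
    congr 1
    field_simp
    ring
  have ht : B 1 1 ≠ 0 := by
    have := B.det_ne_zero
    rw [Matrix.det_fin_two, hB10, mul_zero, sub_zero] at this
    exact right_ne_zero_of_mul this
  ext p
  simp only [Equiv.Perm.mul_apply]
  cases p with
  | infty =>
    rw [zassenhausPerm_infty, if_neg hr, zassenhausPerm_infty, if_pos hB10, permJ_infty]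
    exact congrArg _ (zero_add _).symm
  | coe x =>
    rw [zassenhausPerm_coe A x htwist, zassenhausPerm_coe B x rfl]
    generalize twist hK (B : Matrix (Fin 2) (Fin 2) K).det x = y
    rw [hB10, zero_mul, zero_add, if_neg ht, hB00, hB01]
    rcases eq_or_ne (A 1 0 * y + A 1 1) 0 with hy | hy
    · rw [if_pos hy, hy, zero_div, permJ_zero]
      rfl
    · rw [if_neg hy, permJ_coe (div_ne_zero hy ht), inv_div, hB11]
      refine congrArg _ (?_ : _ = (A 0 1 - A 0 0 * A 1 1 / A 1 0) / (A 1 0 * y + A 1 1) +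
        A 0 0 / A 1 0)
      rw [div_add_div _ _ hy hr, div_eq_div_iff hy (mul_ne_zero hy hr)]
      field_simp
      ring

theorem zassenhausPerm_mem_of_lower_left_eq_zero (hA : permA hK ζ hζ ∈ S) (hT : permT ∈ S)
    (hJ : permJ ∈ S) {A : GL (Fin 2) K} (hr : A 1 0 = 0) : zassenhausPerm hK A ∈ S := by
  have hdet := A.det_ne_zero
  rw [Matrix.det_fin_two, hr, mul_zero, sub_zero] at hdet
  rw [zassenhausPerm_eq_of_lower_left_eq_zero hr (left_ne_zero_of_mul hdet)
    (right_ne_zero_of_mul hdet)]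
  exact S.mul_mem (translation_mem hA hT hJ _) (twistedDilation_mem hA hJ _)

theorem zassenhausPerm_mem (hA : permA hK ζ hζ ∈ S) (hT : permT ∈ S) (hJ : permJ ∈ S)
    (A : GL (Fin 2) K) : zassenhausPerm hK A ∈ S := by
  by_cases hr : A 1 0 = 0
  · exact zassenhausPerm_mem_of_lower_left_eq_zero hA hT hJ hr
  · have hdet : (!![A 1 0, A 1 1; 0, A 0 1 - A 0 0 * A 1 1 / A 1 0]).det ≠ 0 := by
      convert neg_ne_zero.2 A.det_ne_zero
      rw [Matrix.det_fin_two_of, Matrix.det_fin_two]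
      field_simp
      ring
    rw [zassenhausPerm_eq_of_lower_left_ne_zero
      (B := Matrix.GeneralLinearGroup.mkOfDetNeZero _ hdet) hr rfl (isSquare_neg_one hK hζ)]
    exact S.mul_mem (S.mul_mem (translation_mem hA hT hJ _) hJ)
      (zassenhausPerm_mem_of_lower_left_eq_zero hA hT hJ rfl)

theorem zassenhaus_eq_closure (hK : Nat.card K = 9) (ζ : K) (hζ : ζ ^ 2 = 1 - ζ) :
    zassenhaus hK = Subgroup.closure {permA hK ζ hζ, permT, permJ} := by
  apply le_antisymm
  · rw [zassenhaus_eq_closure_range, Subgroup.closure_le, Set.range_subset_iff]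
    exact zassenhausPerm_mem (hζ := hζ) (Subgroup.subset_closure (by simp))
      (Subgroup.subset_closure (by simp)) (Subgroup.subset_closure (by simp))
  · rw [Subgroup.closure_le]
    rintro _ (rfl | rfl | rfl)
    exacts [permA_mem_zassenhaus hK hζ, permT_mem_zassenhaus hK hζ, permJ_mem_zassenhaus hK hζ]

end Zassenhaus

section Generators

variable {K : Type*}

/-- The embedding `h ↦ extend h` of the permutations of the projective line into those of the
twelve points, as a homomorphism. -/
def extendHom (K : Type*) : Equiv.Perm (OnePoint K) →* Equiv.Perm (Points K) where
  toFun := extend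
  map_one' := by ext (_ | _) <;> rfl
  map_mul' _ _ := by ext (_ | _) <;> rfl

variable [Field K] [DecidableEq K]

theorem M12_eq_closure (hK : Nat.card K = 9) (ζ : K) (hζ : ζ ^ 2 = 1 - ζ) :
    M12 hK ζ hζ = Subgroup.closure (Set.range (perm hK ζ hζ)) := by
  have closure_extend : Subgroup.closure (extend '' (zassenhaus hK : Set _)) =
      Subgroup.closure {extend (permA hK ζ hζ), extend permT, extend permJ} :=
    calc Subgroup.closure (extend '' (zassenhaus hK : Set _))
        = (zassenhaus hK).map (extendHom K) := ((zassenhaus hK).map (extendHom K)).closure_eq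
      _ = _ := by
        rw [zassenhaus_eq_closure hK ζ hζ, MonoidHom.map_closure, Set.image_insert_eq,
          Set.image_insert_eq, Set.image_singleton]
        rfl
  rw [M12, M11, Subgroup.closure_union, Subgroup.closure_eq, Subgroup.closure_union,
    closure_extend, ← Subgroup.closure_union, ← Subgroup.closure_union]
  congr 1
  ext x
  constructor
  · rintro (((rfl | rfl | rfl) | rfl) | rfl)
    exacts [⟨.a, rfl⟩, ⟨.T, rfl⟩, ⟨.J, rfl⟩, ⟨.U, rfl⟩, ⟨.V, rfl⟩]
  · rintro ⟨g, rfl⟩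
    cases g <;> simp [perm]

/-- The isomorphism from the presented group to `M₁₂` given by `permHom`. -/
noncomputable def presentedEquiv (hK : Nat.card K = 9) (ζ : K) (hζ : ζ ^ 2 = 1 - ζ) :
    PresentedM12 ≃* M12 hK ζ hζ :=
  (MonoidHom.ofInjective (permHom_injective hK ζ hζ)).trans
    (MulEquiv.subgroupCongr ((range_permHom hK ζ hζ).trans (M12_eq_closure hK ζ hζ).symm))

end Generators

end Mathieu

theorem proposition7p4 {K : Type*} [Field K] [DecidableEq K] (hK : Nat.card K = 9) (ζ : K)
    (hζ : ζ ^ 2 = 1 - ζ) :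
    ∃ e : Mathieu.PresentedM12 ≃* Mathieu.M12 hK ζ hζ,
      (e (PresentedGroup.of Mathieu.Gen.a) : Equiv.Perm (Mathieu.Points K)) =
        Mathieu.extend (Mathieu.permA hK ζ hζ) ∧
      (e (PresentedGroup.of Mathieu.Gen.T) : Equiv.Perm (Mathieu.Points K)) =
        Mathieu.extend Mathieu.permT ∧
      (e (PresentedGroup.of Mathieu.Gen.J) : Equiv.Perm (Mathieu.Points K)) =
        Mathieu.extend Mathieu.permJ ∧
      (e (PresentedGroup.of Mathieu.Gen.U) : Equiv.Perm (Mathieu.Points K)) =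
        Mathieu.permU hK ζ hζ ∧
      (e (PresentedGroup.of Mathieu.Gen.V) : Equiv.Perm (Mathieu.Points K)) =
        Mathieu.permV hK :=
  ⟨Mathieu.presentedEquiv hK ζ hζ, Mathieu.permHom_of hK ζ hζ .a, Mathieu.permHom_of hK ζ hζ .T,
    Mathieu.permHom_of hK ζ hζ .J, Mathieu.permHom_of hK ζ hζ .U, Mathieu.permHom_of hK ζ hζ .V⟩
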